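/- Let $P$ be the transition matrix of a Markov chain on a finite state space $V$, and let $P_L=(P+I)/2$ be its lazy version. If $X,Y$ are independent chains with transition matrix $P_L$ started at $x,y\in V$, let $\tau_I=\inf\{t\ge 0:\{X_0,\dots,X_t\}\cap\{Y_0,\dots,Y_t\}\neq\emptyset\}$ be their intersection time, and put $t_I(P_L)=\max_{x,y}\mathbb{E}_{x,y}[\tau_I]$. If $\pi$ is the stationary distribution, let $t_{\mathrm{mix}}(P_L)=\min\{t\ge 0:\max_x\|P_L^t(x,\cdot)-\pi\|_{\mathrm{TV}}\le 1/4\}$ be the total variation mixing time. (a) There is a universal constant $C\in(0,\infty)$ such that for every finite state space $V$ and every irreducible transition matrix $P$ on $V$ that is reversible with respect to its stationary distribution $\pi$, $$t_{\mathrm{mix}}(P_L)\le C\,t_I(P_L).$$ (b) There are universal constants $c,C\in(0,\infty)$ such that for every finite tree $T$ and every assignment of positive symmetric weights $w(x,y)=w(y,x)$ to the edges of $T$, if $P(x,y)=w(x,y)/\sum_z w(x,z)$ is the transition matrix of the weighted random walk on $T$ (with $P$ the identity if $T$ has a single vertex), then $$c\,t_I(P_L)\le t_{\mathrm{mix}}(P_L)\le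 C\,t_I(P_L).$$ -/

import Mathlib

open MeasureTheory ProbabilityTheory
open scoped ENNReal NNReal

noncomputable section

namespace IntersectionTime

variable {V : Type*} [Fintype V] [DecidableEq V]

/-- A transition matrix on the finite state space `V` is a row-stochastic real matrix. -/
abbrev TransitionMatrix (V : Type*) [Fintype V] [DecidableEq V] :=
  Matrix.rowStochastic ℝ V

/-- The lazy version `(P + I) / 2` of the chain with transition matrix `P`. -/
def lazyVersion (P : TransitionMatrix V) : TransitionMatrix V :=
  ⟨(1 / 2 : ℝ) • (P.1 + 1), by
    obtain ⟨h0, h1⟩ := Matrix.mem_rowStochastic_iff_sum.1 P.2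
    refine Matrix.mem_rowStochastic_iff_sum.2 ⟨fun i j => ?_, fun i => ?_⟩
    · have h2 : (0 : ℝ) ≤ (1 : Matrix V V ℝ) i j := by
        rw [Matrix.one_apply]; split_ifs <;> norm_num
      have h3 := h0 i j
      simp only [Matrix.smul_apply, Matrix.add_apply, smul_eq_mul]
      positivity
    · simp only [Matrix.smul_apply, Matrix.add_apply, smul_eq_mul, ← Finset.mul_sum,
        Finset.sum_add_distrib, h1, Matrix.one_apply, Finset.sum_ite_eq, Finset.mem_univ,
        if_true]
      norm_num⟩

/-- `π` is a probability vector on `V`. -/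
def IsProbVector (π : V → ℝ) : Prop :=
  (∀ x, 0 ≤ π x) ∧ ∑ x, π x = 1

/-- `π` is a stationary distribution of the chain with transition matrix `P`. -/
def IsStationary (P : TransitionMatrix V) (π : V → ℝ) : Prop :=
  IsProbVector π ∧ ∀ y, ∑ x, π x * P.1 x y = π y

/-- The chain with transition matrix `P` is reversible with respect to `π` (detailed balance). -/
def IsReversible (P : TransitionMatrix V) (π : V → ℝ) : Prop :=
  ∀ x y, π x * P.1 x y = π y * P.1 y x

section Law

variable [MeasurableSpace V] [DiscreteMeasurableSpace V]

/-- The one-step distribution `P(x, ·)`, as a probability mass function. -/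
def stepPMF (P : TransitionMatrix V) (x : V) : PMF V :=
  PMF.ofFintype (fun y => ENNReal.ofReal (P.1 x y)) (by
    obtain ⟨h0, h1⟩ := Matrix.mem_rowStochastic_iff_sum.1 P.2
    rw [← ENNReal.ofReal_sum_of_nonneg (fun y _ => h0 x y), h1, ENNReal.ofReal_one])

/-- The one-step Markov kernel `x ↦ P(x, ·)`. -/
def stepKernel (P : TransitionMatrix V) : Kernel V V :=
  ⟨fun x => (stepPMF P x).toMeasure, measurable_of_finite _⟩

instance (P : TransitionMatrix V) : IsMarkovKernel (stepKernel P) :=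
  ⟨fun x => PMF.toMeasure.isProbabilityMeasure (stepPMF P x)⟩

/-- Given the history up to time `n`, the next state is drawn from `P(x, ·)`,
where `x` is the state at time `n`. -/
def historyKernel (P : TransitionMatrix V) (n : ℕ) :
    Kernel ((i : Finset.Iic n) → (fun _ : ℕ => V) i) V :=
  (stepKernel P).comap (fun h => h ⟨n, Finset.mem_Iic.2 le_rfl⟩) (measurable_pi_apply _)

instance (P : TransitionMatrix V) (n : ℕ) : IsMarkovKernel (historyKernel P n) := by
  unfold historyKernel; infer_instance

/-- The law on trajectories `ℕ → V` of the Markov chain with transition matrix `P`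
started at `x` (given by the Ionescu-Tulcea theorem). -/
def chainLaw (P : TransitionMatrix V) (x : V) : Measure (ℕ → V) :=
  Kernel.traj (X := fun _ : ℕ => V) (historyKernel P) 0 (fun _ => x)

end Law

/-- The intersection time of two trajectories: the infimum of the times `t ≥ 0` such that
`{X 0, …, X t} ∩ {Y 0, …, Y t} ≠ ∅` (it is `∞` if there is no such `t`). -/
def interTime (X Y : ℕ → V) : ℝ≥0∞ :=
  ⨅ t ∈ {t : ℕ | (X '' Set.Iic t ∩ Y '' Set.Iic t).Nonempty}, (t : ℝ≥0∞)

/-- The expected intersection time of two independent chains with transition matrix `P`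
started at `x` and `y`. -/
def expInterTime [MeasurableSpace V] [DiscreteMeasurableSpace V]
    (P : TransitionMatrix V) (x y : V) : ℝ≥0∞ :=
  ∫⁻ ω, interTime ω.1 ω.2 ∂((chainLaw P x).prod (chainLaw P y))

/-- `t_I`: the expected intersection time, maximized over the two starting states. -/
def tI [MeasurableSpace V] [DiscreteMeasurableSpace V] (P : TransitionMatrix V) : ℝ≥0∞ :=
  ⨆ (x : V) (y : V), expInterTime P x y

/-- Total variation distance of two probability vectors. -/
def tvDist (μ ν : V → ℝ) : ℝ :=
  (1 / 2) * ∑ y, |μ y - ν y|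

/-- `t_mix = t_mix(1/4)`: the total variation mixing time of the chain with transition matrix
`P` and stationary distribution `π`, i.e. the least `t ≥ 0` such that
`‖P^t(x, ·) - π‖_TV ≤ 1/4` for every starting state `x`. -/
def tmix (P : TransitionMatrix V) (π : V → ℝ) : ℝ≥0∞ :=
  ⨅ t ∈ {t : ℕ | ∀ x, tvDist ((P.1 ^ t) x) π ≤ 1 / 4}, (t : ℝ≥0∞)

/-- Positive symmetric weights on the edges of the graph `G` (extended by `0` to non-edges). -/
structure EdgeWeights (G : SimpleGraph V) where
  w : V → V → ℝ
  symm : ∀ x y, w x y = w y x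
  pos : ∀ x y, G.Adj x y → 0 < w x y
  zero : ∀ x y, ¬ G.Adj x y → w x y = 0

/-- The transition matrix of the weighted random walk: from `x` the walk moves to `y` with
probability `w x y / ∑ z, w x z`. A vertex without neighbours (only the vertex of a one-vertex
graph, if `G` is connected) is absorbing. -/
def weightedWalk {G : SimpleGraph V} (W : EdgeWeights G) : TransitionMatrix V :=
  ⟨Matrix.of fun x y =>
      if ∑ z, W.w x z = 0 then (if x = y then 1 else 0) else W.w x y / ∑ z, W.w x z, by
    have h0 : ∀ x y, 0 ≤ W.w x y := fun x y => by
      by_cases h : G.Adj x y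
      · exact (W.pos x y h).le
      · exact (W.zero x y h).ge
    refine Matrix.mem_rowStochastic_iff_sum.2 ⟨fun x y => ?_, fun x => ?_⟩
    · simp only [Matrix.of_apply]
      split_ifs
      · exact zero_le_one
      · exact le_rfl
      · exact div_nonneg (h0 x y) (Finset.sum_nonneg fun z _ => h0 x z)
    · simp only [Matrix.of_apply]
      split_ifs with h
      · simp
      · rw [← Finset.sum_div, div_self h]⟩

end IntersectionTime

end

/-!
The upper bound on the mixing time rests on one observation. Let `F` be the average of
`f, P f, …, P ^ (R - 1) f`, where `|f| ≤ 1`. Then `|P F - F| ≤ 2 / R`, so along the chain `F` is a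
martingale up to a drift of `2 / R` per step. Start one chain at a minimum and the other at a
maximum of `F`. By the discrete maximal inequality (`one_sub_avoidProb_le`), for `s` much smaller
than `R` both are likely to remain up to time `s` in the lower and the upper half of the range of
`F` respectively, unless that range is short, and then they do not intersect. Hence if `R` is a
large multiple of the expected intersection time, `F` is nearly constant (`timeAverage_sub_le`):
the law of the chain at a uniform time in `{0, …, R - 1}` is close to `π` in total variation. This
part needs neither reversibility nor laziness.

For a lazy reversible chain a uniform random time can be replaced by a fixed one. On `L²(π)` the
matrix `P` is self-adjoint with `0 ≤ P ≤ 1`, so `P ^ m - P ^ (m + 1)` has norm at most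
`1 / (m + 1)` (`IsPositiveContraction.sq_mul_inner_le`), and for `M` a large multiple of `R` the
functions `P ^ m f` with `M ≤ m ≤ M + R` differ by an amount whose supremum over `m` has small
`π`-mean. Splitting a run of `M + R` steps after a uniform number of steps, the first part is
nearly `π`-distributed, and the number of steps in the second part hardly matters
(`IsPositiveContraction.abs_pow_mulVec_sub_le`).

On a tree, a stationary chain that moves along edges is reversible because a single edge joins
each branch to its complement (`isReversible_of_isTree`), so the same bound applies. Conversely,
there is a vertex all of whose branches have mass at most `1 / 2` (`exists_central_vertex`). At
the mixing time the chain has left its initial branch with probability at least `1 / 4`, which it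
can only do through the central vertex; hence both chains visit that vertex within a mean time of
four mixing times each (`tI_le_tmix`).
-/

noncomputable section

namespace IntersectionTime

variable {V : Type*} [Fintype V] [DecidableEq V]

/-! ### Avoidance probabilities -/

/-- The probability that the chain with transition matrix `P` started at `x` stays outside `B`
during the times `0, …, s`, defined by the first-step recursion. -/
def avoidProb (P : TransitionMatrix V) (B : Finset V) : ℕ → V → ℝ
  | 0, x => if x ∈ B then 0 else 1
  | s + 1, x => if x ∈ B then 0 else ∑ z, P.1 x z * avoidProb P B s z

lemma transition_nonneg (P : TransitionMatrix V) (x y : V) : 0 ≤ P.1 x y :=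
  (Matrix.mem_rowStochastic_iff_sum.1 P.2).1 x y

lemma sum_transition (P : TransitionMatrix V) (x : V) : ∑ y, P.1 x y = 1 :=
  (Matrix.mem_rowStochastic_iff_sum.1 P.2).2 x

lemma avoidProb_of_mem (P : TransitionMatrix V) {B : Finset V} (s : ℕ) {x : V} (hx : x ∈ B) :
    avoidProb P B s x = 0 := by
  cases s <;> simp [avoidProb, hx]

lemma avoidProb_nonneg (P : TransitionMatrix V) (B : Finset V) (s : ℕ) (x : V) :
    0 ≤ avoidProb P B s x := by
  induction s generalizing x with
  | zero => unfold avoidProb; split_ifs <;> norm_num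
  | succ s ih =>
    unfold avoidProb
    split_ifs
    · exact le_rfl
    · exact Finset.sum_nonneg fun z _ => mul_nonneg (transition_nonneg P x z) (ih z)

lemma avoidProb_le_one (P : TransitionMatrix V) (B : Finset V) (s : ℕ) (x : V) :
    avoidProb P B s x ≤ 1 := by
  induction s generalizing x with
  | zero => unfold avoidProb; split_ifs <;> norm_num
  | succ s ih =>
    unfold avoidProb
    split_ifs
    · norm_num
    · calc ∑ z, P.1 x z * avoidProb P B s z ≤ ∑ z, P.1 x z * 1 :=
            Finset.sum_le_sum fun z _ => mul_le_mul_of_nonneg_left (ih z) (transition_nonneg P x z)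
        _ = 1 := by simp [sum_transition]

/-- Markov property at time `s`. -/
lemma avoidProb_add_le (P : TransitionMatrix V) (B : Finset V) {t : ℕ} {q : ℝ}
    (hq : ∀ x, avoidProb P B t x ≤ q) (s : ℕ) (x : V) :
    avoidProb P B (s + t) x ≤ q * avoidProb P B s x := by
  induction s generalizing x with
  | zero =>
    by_cases hx : x ∈ B
    · simp [avoidProb_of_mem P _ hx]
    · simpa [avoidProb, hx] using hq x
  | succ s ih =>
    by_cases hx : x ∈ B
    · simp [avoidProb_of_mem P _ hx]
    · rw [Nat.add_right_comm]
      simp only [avoidProb, hx, if_false, Finset.mul_sum]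
      refine Finset.sum_le_sum fun z _ => ?_
      calc _ ≤ P.1 x z * (q * avoidProb P B s z) :=
            mul_le_mul_of_nonneg_left (ih z) (transition_nonneg P x z)
        _ = _ := by ring

/-- If from every state the set `B` is hit by time `t` with probability at least `1 / 4`, then
its expected hitting time is at most `4 * t`. -/
lemma sum_avoidProb_le (P : TransitionMatrix V) (B : Finset V) {t : ℕ}
    (ht : ∀ x, avoidProb P B t x ≤ 3 / 4) (N : ℕ) (x : V) :
    ∑ s ∈ Finset.range N, avoidProb P B s x ≤ 4 * t := by
  have h1 : ∑ s ∈ Finset.range N, avoidProb P B s x ≤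
      ∑ s ∈ Finset.range (t + N), avoidProb P B s x :=
    Finset.sum_le_sum_of_subset_of_nonneg (Finset.range_mono (by omega))
      fun s _ _ => avoidProb_nonneg P B s x
  have h2 : ∑ s ∈ Finset.range t, avoidProb P B s x ≤ t := by
    calc _ ≤ ∑ s ∈ Finset.range t, (1 : ℝ) :=
          Finset.sum_le_sum fun s _ => avoidProb_le_one P B s x
      _ = t := by simp
  have h3 : ∑ s ∈ Finset.range N, avoidProb P B (t + s) x ≤
      3 / 4 * ∑ s ∈ Finset.range N, avoidProb P B s x := by
    rw [Finset.mul_sum]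
    refine Finset.sum_le_sum fun s _ => ?_
    rw [Nat.add_comm]
    exact avoidProb_add_le P B ht s x
  rw [Finset.sum_range_add] at h1
  linarith

/-- Discrete maximal inequality: if `P f ≤ f + p`, then a nonnegative `f` started at `f x`
reaches the level `a` by time `s` with probability at most `(f x + s * p) / a`. -/
lemma one_sub_avoidProb_le (P : TransitionMatrix V) (B : Finset V) (f : V → ℝ) {p a : ℝ}
    (hp : 0 ≤ p) (hf : ∀ x, 0 ≤ f x) (hB : ∀ x ∈ B, a ≤ f x)
    (hP : ∀ x, ∑ z, P.1 x z * f z ≤ f x + p) (s : ℕ) (x : V) :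
    a * (1 - avoidProb P B s x) ≤ f x + s * p := by
  have hsp : 0 ≤ s * p := by positivity
  by_cases hx : x ∈ B
  · rw [avoidProb_of_mem P _ hx]
    linarith [hB x hx]
  · induction s generalizing x with
    | zero => simpa [avoidProb, hx] using hf x
    | succ s ih =>
      have hsp : 0 ≤ s * p := by positivity
      have h1 : ∀ z, a * (1 - avoidProb P B s z) ≤ f z + s * p := fun z => by
        by_cases hz : z ∈ B
        · rw [avoidProb_of_mem P _ hz]
          linarith [hB z hz]
        · exact ih z hsp hz
      have h2 : a * (1 - ∑ z, P.1 x z * avoidProb P B s z) =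
          ∑ z, P.1 x z * (a * (1 - avoidProb P B s z)) := by
        simp only [mul_sub, mul_one, Finset.sum_sub_distrib, ← Finset.sum_mul, sum_transition,
          one_mul, Finset.mul_sum]
        exact congrArg _ (Finset.sum_congr rfl fun z _ => by ring)
      have h3 : ∑ z, P.1 x z * (f z + s * p) = ∑ z, P.1 x z * f z + s * p := by
        simp only [mul_add, Finset.sum_add_distrib, ← Finset.sum_mul, sum_transition, one_mul]
      simp only [avoidProb, hx, if_false]
      rw [h2]
      calc _ ≤ ∑ z, P.1 x z * (f z + s * p) :=
            Finset.sum_le_sum fun z _ => mul_le_mul_of_nonneg_left (h1 z) (transition_nonneg P x z)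
        _ ≤ f x + p + s * p := by rw [h3]; linarith [hP x]
        _ = _ := by push_cast; ring

section VisitTime

omit [Fintype V]

/-- The time of the first visit of a trajectory to `v`, written as the number of times `s` such
that `v` is not visited up to time `s`. -/
def visitTime (v : V) (ω : ℕ → V) : ℝ≥0∞ :=
  ∑' s : ℕ, {ω : ℕ → V | ∀ i ≤ s, ω i ∉ ({v} : Finset V)}.indicator 1 ω

lemma exists_le_visitTime {v : V} {ω : ℕ → V} (h : visitTime v ω ≠ ∞) :
    ∃ i : ℕ, ω i = v ∧ (i : ℝ≥0∞) ≤ visitTime v ω := by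
  have hex : ∃ i, ω i = v := by
    by_contra! hne
    refine h ?_
    have : ∀ s : ℕ, {ω : ℕ → V | ∀ i ≤ s, ω i ∉ ({v} : Finset V)}.indicator
        (1 : (ℕ → V) → ℝ≥0∞) ω = 1 := fun s =>
      Set.indicator_of_mem (fun i _ => by simpa using hne i) _
    simp only [visitTime, this]
    exact ENNReal.tsum_const_eq_top_of_ne_zero one_ne_zero
  refine ⟨Nat.find hex, Nat.find_spec hex, ?_⟩
  calc ((Nat.find hex : ℕ) : ℝ≥0∞) = ∑ s ∈ Finset.range (Nat.find hex), (1 : ℝ≥0∞) := by simp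
    _ = ∑ s ∈ Finset.range (Nat.find hex),
          {ω : ℕ → V | ∀ i ≤ s, ω i ∉ ({v} : Finset V)}.indicator 1 ω := by
        refine Finset.sum_congr rfl fun s hs => ?_
        have hmem : ω ∈ {ω : ℕ → V | ∀ i ≤ s, ω i ∉ ({v} : Finset V)} := fun i hi => by
          simpa using Nat.find_min hex (lt_of_le_of_lt hi (Finset.mem_range.1 hs))
        rw [Set.indicator_of_mem hmem, Pi.one_apply]
    _ ≤ visitTime v ω := ENNReal.sum_le_tsum _

lemma interTime_le_visitTime_add (v : V) (X Y : ℕ → V) :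
    interTime X Y ≤ visitTime v X + visitTime v Y := by
  by_cases hX : visitTime v X = ∞
  · simp [hX]
  by_cases hY : visitTime v Y = ∞
  · simp [hY]
  obtain ⟨i, hi, hiv⟩ := exists_le_visitTime hX
  obtain ⟨j, hj, hjv⟩ := exists_le_visitTime hY
  calc interTime X Y ≤ ((i + j : ℕ) : ℝ≥0∞) :=
        iInf₂_le _ ⟨v, ⟨i, by simp, hi⟩, ⟨j, by simp, hj⟩⟩
    _ ≤ _ := by push_cast; exact add_le_add hiv hjv

end VisitTime

section Law

variable [MeasurableSpace V] [DiscreteMeasurableSpace V]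

lemma lintegral_stepKernel (P : TransitionMatrix V) (x : V) (f : V → ℝ) (hf : ∀ z, 0 ≤ f z) :
    ∫⁻ z, ENNReal.ofReal (f z) ∂(stepKernel P x) = ENNReal.ofReal (∑ z, P.1 x z * f z) := by
  rw [lintegral_fintype, ENNReal.ofReal_sum_of_nonneg
    fun z _ => mul_nonneg (transition_nonneg P x z) (hf z)]
  refine Finset.sum_congr rfl fun z _ => ?_
  have h : stepKernel P x {z} = ENNReal.ofReal (P.1 x z) := by
    change (stepPMF P x).toMeasure {z} = _
    rw [PMF.toMeasure_apply_singleton _ _ (measurableSet_singleton z)]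
    rfl
  rw [h, ENNReal.ofReal_mul (transition_nonneg P x z), mul_comm]

/-- Under `Kernel.traj κ n h` the trajectory almost surely continues the history `h`. -/
lemma traj_eval_ae (P : TransitionMatrix V) (n : ℕ)
    (h : (i : Finset.Iic n) → (fun _ : ℕ => V) i) :
    ∀ᵐ ω ∂(Kernel.traj (X := fun _ : ℕ => V) (historyKernel P) n h),
      ω n = h ⟨n, Finset.mem_Iic.2 le_rfl⟩ := by
  rw [← Kernel.traj_map_updateFinset]
  rw [ae_map_iff (by fun_prop) (measurableSet_eq_fun (measurable_pi_apply n) measurable_const)]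
  filter_upwards with ω
  simp [Function.updateFinset]

omit [Fintype V] [DecidableEq V] in
lemma measurableSet_avoid (B : Finset V) (n m : ℕ) :
    MeasurableSet {ω : ℕ → V | ∀ i, n ≤ i → i ≤ m → ω i ∉ B} := by
  have : {ω : ℕ → V | ∀ i, n ≤ i → i ≤ m → ω i ∉ B} =
      ⋂ i, ⋂ (_ : n ≤ i), ⋂ (_ : i ≤ m), (fun ω : ℕ → V => ω i) ⁻¹' {z | z ∉ B} := by
    ext; simp
  rw [this]
  exact MeasurableSet.iInter fun i => MeasurableSet.iInter fun _ => MeasurableSet.iInter fun _ =>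
    measurable_pi_apply i (MeasurableSet.of_discrete)

/-- Given the history up to time `n`, the probability of avoiding `B` during the times
`n, …, n + s` is given by the recursion of `avoidProb`. The start `n` varies because the step in `s`
extends the history by one state. -/
lemma traj_avoid (P : TransitionMatrix V) (B : Finset V) (s n : ℕ)
    (h : (i : Finset.Iic n) → (fun _ : ℕ => V) i) :
    Kernel.traj (X := fun _ : ℕ => V) (historyKernel P) n h
        {ω | ∀ i, n ≤ i → i ≤ n + s → ω i ∉ B} =
      ENNReal.ofReal (avoidProb P B s (h ⟨n, Finset.mem_Iic.2 le_rfl⟩)) := by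
  by_cases hx : h ⟨n, Finset.mem_Iic.2 le_rfl⟩ ∈ B
  · rw [avoidProb_of_mem P _ hx, ENNReal.ofReal_zero]
    refine measure_mono_null (fun ω hω => ?_) (ae_iff.1 (traj_eval_ae P n h))
    intro heq
    exact hω n le_rfl (by omega) (heq ▸ hx)
  induction s generalizing n with
  | zero =>
    simp only [avoidProb, hx, if_false, ENNReal.ofReal_one]
    refine (prob_compl_eq_zero_iff (measurableSet_avoid B _ _)).1 ?_
    refine measure_mono_null (fun ω hω => ?_) (ae_iff.1 (traj_eval_ae P n h))
    intro heq
    refine hω fun i h1 h2 => ?_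
    obtain rfl : i = n := by omega
    rw [heq]; exact hx
  | succ s ih =>
    have h1 : Kernel.traj (X := fun _ : ℕ => V) (historyKernel P) n h
        {ω | ∀ i, n ≤ i → i ≤ n + (s + 1) → ω i ∉ B} =
        Kernel.traj (X := fun _ : ℕ => V) (historyKernel P) n h
          {ω | ∀ i, n + 1 ≤ i → i ≤ n + 1 + s → ω i ∉ B} := by
      refine measure_congr ?_
      filter_upwards [traj_eval_ae P n h] with ω hω
      refine propext ⟨fun H i h1 h2 => H i (by omega) (by omega), fun H i h1 h2 => ?_⟩
      rcases h1.eq_or_lt with rfl | h3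
      · rw [hω]; exact hx
      · exact H i (by omega) (by omega)
    rw [h1, ← Kernel.traj_comp_partialTraj (Nat.le_succ n),
      Kernel.comp_apply' _ _ _ (measurableSet_avoid B _ _)]
    have h2 : ∀ h' : (i : Finset.Iic (n + 1)) → (fun _ : ℕ => V) i,
        Kernel.traj (X := fun _ : ℕ => V) (historyKernel P) (n + 1) h'
          {ω | ∀ i, n + 1 ≤ i → i ≤ n + 1 + s → ω i ∉ B} =
        ENNReal.ofReal (avoidProb P B s (h' ⟨n + 1, Finset.mem_Iic.2 le_rfl⟩)) := fun h' => by
      by_cases hz : h' ⟨n + 1, Finset.mem_Iic.2 le_rfl⟩ ∈ B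
      · rw [avoidProb_of_mem P _ hz, ENNReal.ofReal_zero]
        refine measure_mono_null (fun ω hω => ?_) (ae_iff.1 (traj_eval_ae P (n + 1) h'))
        intro heq
        exact hω (n + 1) le_rfl (by omega) (heq ▸ hz)
      · exact ih (n + 1) h' hz
    simp only [Nat.succ_eq_add_one, h2]
    have h3 := Kernel.map_partialTraj_succ_self (X := fun _ : ℕ => V) (κ := historyKernel P) n
    have h4 : ∫⁻ z, ENNReal.ofReal (avoidProb P B s z) ∂(historyKernel P n h) =
        ∫⁻ h', ENNReal.ofReal (avoidProb P B s (h' ⟨n + 1, Finset.mem_Iic.2 le_rfl⟩))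
          ∂(Kernel.partialTraj (X := fun _ : ℕ => V) (historyKernel P) n (n + 1) h) := by
      rw [← h3, Kernel.map_apply _ (measurable_pi_apply _),
        lintegral_map (Measurable.of_discrete) (measurable_pi_apply _)]
    rw [← h4]
    change ∫⁻ z, _ ∂(stepKernel P (h ⟨n, _⟩)) = _
    rw [lintegral_stepKernel P _ _ (avoidProb_nonneg P B s)]
    simp only [avoidProb, hx, if_false]

/-- The recursively defined `avoidProb` is the corresponding probability under the law of the
trajectory. -/
lemma chainLaw_avoid (P : TransitionMatrix V) (B : Finset V) (s : ℕ) (x : V) :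
    chainLaw P x {ω | ∀ i ≤ s, ω i ∉ B} = ENNReal.ofReal (avoidProb P B s x) := by
  have := traj_avoid P B s 0 (fun _ => x)
  simpa [chainLaw] using this

instance (P : TransitionMatrix V) (x : V) : IsProbabilityMeasure (chainLaw P x) := by
  unfold chainLaw; infer_instance

omit [Fintype V] [DecidableEq V] in
lemma measurableSet_avoid_zero (B : Finset V) (s : ℕ) :
    MeasurableSet {ω : ℕ → V | ∀ i ≤ s, ω i ∉ B} := by
  simpa using measurableSet_avoid B 0 s

/-- If one chain stays outside `A` and the other outside `B` up to time `s`, where `A` and `B`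
cover the state space, then the trajectories do not intersect by time `s`. -/
lemma avoidProb_mul_le_expInterTime (P : TransitionMatrix V) {A B : Finset V}
    (hAB : ∀ z, z ∈ A ∨ z ∈ B) (s : ℕ) (x y : V) :
    ENNReal.ofReal ((s + 1) * (avoidProb P A s x * avoidProb P B s y)) ≤ expInterTime P x y := by
  set S := {ω : ℕ → V | ∀ i ≤ s, ω i ∉ A} ×ˢ {ω : ℕ → V | ∀ i ≤ s, ω i ∉ B} with hS
  have hSm : MeasurableSet S := (measurableSet_avoid_zero A s).prod (measurableSet_avoid_zero B s)
  calc ENNReal.ofReal ((s + 1) * (avoidProb P A s x * avoidProb P B s y))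
      = ((s + 1 : ℕ) : ℝ≥0∞) * ((chainLaw P x).prod (chainLaw P y)) S := by
        rw [hS, Measure.prod_prod, chainLaw_avoid, chainLaw_avoid,
          ENNReal.ofReal_mul (by positivity), ENNReal.ofReal_mul (avoidProb_nonneg P A s x)]
        congr 1
        rw [← ENNReal.ofReal_natCast]
        push_cast
        rfl
    _ = ∫⁻ ω, S.indicator (fun _ => ((s + 1 : ℕ) : ℝ≥0∞)) ω
          ∂((chainLaw P x).prod (chainLaw P y)) := by
        rw [lintegral_indicator_const hSm]
    _ ≤ expInterTime P x y := by
        refine lintegral_mono fun ω => ?_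
        by_cases hω : ω ∈ S
        swap
        · rw [Set.indicator_of_notMem hω]; exact zero_le
        rw [Set.indicator_of_mem hω]
        refine le_iInf₂ fun t ht => ?_
        obtain ⟨z, ⟨i, hi, hiz⟩, ⟨j, hj, hjz⟩⟩ := ht
        have : s < t := by
          by_contra! hst
          rcases hAB z with hz | hz
          · exact hω.1 i (le_trans hi hst) (hiz ▸ hz)
          · exact hω.2 j (le_trans hj hst) (hjz ▸ hz)
        exact_mod_cast this

omit [Fintype V] [DecidableEq V] in
lemma measurable_visitTime (v : V) : Measurable (visitTime v) :=
  Measurable.tsum fun s => measurable_one.indicator (measurableSet_avoid_zero _ s)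

lemma lintegral_visitTime_le (P : TransitionMatrix V) (v : V) {t : ℕ}
    (ht : ∀ x, avoidProb P {v} t x ≤ 3 / 4) (x : V) :
    ∫⁻ ω, visitTime v ω ∂(chainLaw P x) ≤ 4 * t := by
  unfold visitTime
  rw [lintegral_tsum fun s =>
    (measurable_one.indicator (measurableSet_avoid_zero _ s)).aemeasurable]
  refine ENNReal.tsum_le_of_sum_range_le fun N => ?_
  calc _ = ∑ s ∈ Finset.range N, ENNReal.ofReal (avoidProb P {v} s x) := by
        refine Finset.sum_congr rfl fun s _ => ?_
        rw [lintegral_indicator_one (measurableSet_avoid_zero _ s), chainLaw_avoid]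
    _ = ENNReal.ofReal (∑ s ∈ Finset.range N, avoidProb P {v} s x) :=
        (ENNReal.ofReal_sum_of_nonneg fun s _ => avoidProb_nonneg P _ s x).symm
    _ ≤ ENNReal.ofReal (4 * t) := ENNReal.ofReal_le_ofReal (sum_avoidProb_le P _ ht N x)
    _ = 4 * t := by
        rw [ENNReal.ofReal_mul (by norm_num), ENNReal.ofReal_natCast]; norm_num

lemma expInterTime_le (P : TransitionMatrix V) (v : V) {t : ℕ}
    (ht : ∀ x, avoidProb P {v} t x ≤ 3 / 4) (x y : V) :
    expInterTime P x y ≤ 8 * t := by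
  calc expInterTime P x y
      ≤ ∫⁻ ω, (visitTime v ω.1 + visitTime v ω.2) ∂((chainLaw P x).prod (chainLaw P y)) :=
        lintegral_mono fun ω => interTime_le_visitTime_add v ω.1 ω.2
    _ = ∫⁻ ω, visitTime v ω ∂(chainLaw P x) + ∫⁻ ω, visitTime v ω ∂(chainLaw P y) := by
        rw [lintegral_add_left
            (f := fun ω : (ℕ → V) × (ℕ → V) => visitTime v ω.1)
            ((measurable_visitTime v).comp measurable_fst),
          measurePreserving_fst.lintegral_comp (measurable_visitTime v),
          measurePreserving_snd.lintegral_comp (measurable_visitTime v)]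
    _ ≤ 4 * t + 4 * t :=
        add_le_add (lintegral_visitTime_le P v ht x) (lintegral_visitTime_le P v ht y)
    _ = 8 * t := by rw [← add_mul]; norm_num

end Law

/-! ### Powers of the transition matrix acting on functions -/

open Matrix

lemma abs_mulVec_le (P : TransitionMatrix V) {f g : V → ℝ} (h : ∀ x, |f x| ≤ g x) (x : V) :
    |(P.1 *ᵥ f) x| ≤ (P.1 *ᵥ g) x := by
  refine (Finset.abs_sum_le_sum_abs _ _).trans (Finset.sum_le_sum fun y _ => ?_)
  rw [abs_mul, abs_of_nonneg (transition_nonneg P x y)]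
  exact mul_le_mul_of_nonneg_left (h y) (transition_nonneg P x y)

lemma mulVec_const (P : TransitionMatrix V) (c : ℝ) (x : V) : (P.1 *ᵥ fun _ => c) x = c := by
  simp [mulVec, dotProduct, ← Finset.sum_mul, sum_transition]

lemma abs_pow_mulVec_le (P : TransitionMatrix V) (k : ℕ) {f g : V → ℝ} (h : ∀ x, |f x| ≤ g x)
    (x : V) : |((P.1 ^ k) *ᵥ f) x| ≤ ((P.1 ^ k) *ᵥ g) x := by
  simpa using abs_mulVec_le (P ^ k) h x

lemma abs_pow_mulVec_le_const (P : TransitionMatrix V) (k : ℕ) {f : V → ℝ} {c : ℝ}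
    (h : ∀ x, |f x| ≤ c) (x : V) : |((P.1 ^ k) *ᵥ f) x| ≤ c := by
  have := abs_mulVec_le (P ^ k) (g := fun _ => c) h x
  rw [mulVec_const] at this
  simpa using this

lemma pow_succ_mulVec (P : TransitionMatrix V) (k : ℕ) (f : V → ℝ) :
    (P.1 ^ (k + 1)) *ᵥ f = P.1 *ᵥ ((P.1 ^ k) *ᵥ f) := by
  rw [pow_succ', mulVec_mulVec]

lemma stationary_mulVec {P : TransitionMatrix V} {π : V → ℝ} (hπ : IsStationary P π)
    (f : V → ℝ) : ∑ x, π x * (P.1 *ᵥ f) x = ∑ x, π x * f x := by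
  simp only [mulVec, dotProduct, Finset.mul_sum]
  rw [Finset.sum_comm]
  refine Finset.sum_congr rfl fun y _ => ?_
  rw [← hπ.2 y, Finset.sum_mul]
  exact Finset.sum_congr rfl fun x _ => by ring

lemma stationary_pow_mulVec {P : TransitionMatrix V} {π : V → ℝ} (hπ : IsStationary P π) (k : ℕ)
    (f : V → ℝ) : ∑ x, π x * ((P.1 ^ k) *ᵥ f) x = ∑ x, π x * f x := by
  induction k with
  | zero => simp
  | succ k ih => rw [pow_succ_mulVec, stationary_mulVec hπ, ih]

/-! ### Decay of `P ^ m - P ^ (m + 1)` in `L²` for lazy reversible chains -/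

/-- The inner product of `L²(π)`. -/
def weightedInner (π f g : V → ℝ) : ℝ := ∑ x, π x * (f x * g x)

/-- Self-adjointness on `L²(π)` together with `0 ≤ P ≤ 1` as quadratic forms. -/
structure IsPositiveContraction (P : TransitionMatrix V) (π : V → ℝ) : Prop where
  symm : ∀ f g, weightedInner π (P.1 *ᵥ f) g = weightedInner π f (P.1 *ᵥ g)
  nonneg : ∀ f, 0 ≤ weightedInner π (P.1 *ᵥ f) f
  le : ∀ f, weightedInner π (P.1 *ᵥ f) f ≤ weightedInner π f f

lemma lazyVersion_mulVec (P : TransitionMatrix V) (f : V → ℝ) (x : V) :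
    ((lazyVersion P).1 *ᵥ f) x = ((P.1 *ᵥ f) x + f x) / 2 := by
  change (((1 / 2 : ℝ) • (P.1 + 1)) *ᵥ f) x = _
  rw [smul_mulVec, add_mulVec, one_mulVec]
  simp only [Pi.smul_apply, Pi.add_apply, smul_eq_mul]
  ring

lemma isPositiveContraction_lazyVersion {P : TransitionMatrix V} {π : V → ℝ}
    (hπ : IsStationary P π) (hrev : IsReversible P π) :
    IsPositiveContraction (lazyVersion P) π := by
  have hsymm : ∀ f g, weightedInner π (P.1 *ᵥ f) g = weightedInner π f (P.1 *ᵥ g) := fun f g => by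
    simp only [weightedInner, mulVec, dotProduct, Finset.mul_sum, Finset.sum_mul]
    rw [Finset.sum_comm]
    refine Finset.sum_congr rfl fun y _ => Finset.sum_congr rfl fun x _ => ?_
    linear_combination (f y * g x) * hrev x y
  have hlazy : ∀ f g, weightedInner π ((lazyVersion P).1 *ᵥ f) g =
      (weightedInner π (P.1 *ᵥ f) g + weightedInner π f g) / 2 := fun f g => by
    simp only [weightedInner, lazyVersion_mulVec, ← Finset.sum_add_distrib, Finset.sum_div]
    exact Finset.sum_congr rfl fun x _ => by ring
  have hcomm : ∀ f g, weightedInner π f g = weightedInner π g f := fun f g => by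
    simp only [weightedInner, mul_comm (f _)]
  -- `⟨f, f⟩ ± ⟨P f, f⟩` is half the sum of `π x * P x y * (f x ± f y) ^ 2`.
  have hquad : ∀ f : V → ℝ, ∀ ε : ℝ, ε ^ 2 = 1 →
      0 ≤ weightedInner π f f + ε * weightedInner π (P.1 *ᵥ f) f := fun f ε hε => by
    have h0 : 0 ≤ ∑ x, ∑ y, π x * P.1 x y * (f x + ε * f y) ^ 2 :=
      Finset.sum_nonneg fun x _ => Finset.sum_nonneg fun y _ =>
        mul_nonneg (mul_nonneg (hπ.1.1 x) (transition_nonneg P x y)) (sq_nonneg _)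
    have h1 : ∑ x, ∑ y, π x * P.1 x y * (f x + ε * f y) ^ 2 =
        ∑ x, π x * (f x * f x) * ∑ y, P.1 x y +
          2 * ε * weightedInner π (P.1 *ᵥ f) f +
          ∑ x, π x * (P.1 *ᵥ fun y => f y * f y) x := by
      simp only [weightedInner, mulVec, dotProduct, Finset.mul_sum, Finset.sum_mul,
        ← Finset.sum_add_distrib]
      refine Finset.sum_congr rfl fun x _ => Finset.sum_congr rfl fun y _ => ?_
      linear_combination (π x * P.1 x y * (f y) ^ 2) * hε
    rw [stationary_mulVec hπ] at h1
    simp only [sum_transition, mul_one] at h1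
    have h2 : weightedInner π f f = ∑ x, π x * (f x * f x) := rfl
    rw [← h2] at h1
    linarith
  refine ⟨fun f g => ?_, fun f => ?_, fun f => ?_⟩
  · rw [hlazy, hsymm, hcomm f ((lazyVersion P).1 *ᵥ g), hlazy, hcomm (P.1 *ᵥ g), hcomm g]
  · rw [hlazy]
    linarith [hquad f 1 (by norm_num)]
  · rw [hlazy]
    linarith [hquad f (-1) (by norm_num)]

namespace IsPositiveContraction

variable {P : TransitionMatrix V} {π : V → ℝ}

lemma inner_pow (h : IsPositiveContraction P π) (f : V → ℝ) (i j : ℕ) :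
    weightedInner π ((P.1 ^ i) *ᵥ f) ((P.1 ^ j) *ᵥ f) =
      weightedInner π ((P.1 ^ (i + j)) *ᵥ f) f := by
  induction j generalizing i with
  | zero => simp
  | succ j ih => rw [pow_succ_mulVec, ← h.symm, ← pow_succ_mulVec, ih, Nat.add_right_comm]; rfl

lemma inner_pow_nonneg (h : IsPositiveContraction P π) (hπ : ∀ x, 0 ≤ π x) (f : V → ℝ) (k : ℕ) :
    0 ≤ weightedInner π ((P.1 ^ k) *ᵥ f) f := by
  obtain ⟨i, rfl | rfl⟩ := Nat.even_or_odd' k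
  · rw [two_mul, ← h.inner_pow]
    exact Finset.sum_nonneg fun x _ => mul_nonneg (hπ x) (mul_self_nonneg _)
  · rw [two_mul, Nat.add_right_comm, ← h.inner_pow, pow_succ_mulVec]
    exact h.nonneg _

/-- The quadratic form of `P ^ k` at `f - P f` is a second difference of the one at `f`. -/
lemma inner_pow_sub (h : IsPositiveContraction P π) (f : V → ℝ) (k : ℕ) :
    weightedInner π ((P.1 ^ k) *ᵥ (f - P.1 *ᵥ f)) (f - P.1 *ᵥ f) =
      weightedInner π ((P.1 ^ k) *ᵥ f) f - 2 * weightedInner π ((P.1 ^ (k + 1)) *ᵥ f) f +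
        weightedInner π ((P.1 ^ (k + 2)) *ᵥ f) f := by
  have h1 : (P.1 ^ k) *ᵥ (f - P.1 *ᵥ f) = (P.1 ^ k) *ᵥ f - (P.1 ^ (k + 1)) *ᵥ f := by
    rw [mulVec_sub, mulVec_mulVec, pow_succ]
  have h2 := h.inner_pow f k 1
  have h3 := h.inner_pow f (k + 1) 1
  have h4 : weightedInner π ((P.1 ^ k) *ᵥ f - (P.1 ^ (k + 1)) *ᵥ f) (f - P.1 *ᵥ f) =
      weightedInner π ((P.1 ^ k) *ᵥ f) f - weightedInner π ((P.1 ^ (k + 1)) *ᵥ f) f -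
      weightedInner π ((P.1 ^ k) *ᵥ f) ((P.1 ^ 1) *ᵥ f) +
      weightedInner π ((P.1 ^ (k + 1)) *ᵥ f) ((P.1 ^ 1) *ᵥ f) := by
    simp only [weightedInner, pow_one, ← Finset.sum_sub_distrib, ← Finset.sum_add_distrib,
      Pi.sub_apply]
    exact Finset.sum_congr rfl fun x _ => by ring
  rw [h1, h4, h2, h3]
  ring

lemma inner_pow_succ_le (h : IsPositiveContraction P π) (f : V → ℝ) (k : ℕ) :
    weightedInner π ((P.1 ^ (k + 1)) *ᵥ f) f ≤ weightedInner π ((P.1 ^ k) *ᵥ f) f := by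
  have heven : ∀ i, weightedInner π ((P.1 ^ (2 * i + 1)) *ᵥ f) f ≤
      weightedInner π ((P.1 ^ (2 * i)) *ᵥ f) f := fun i => by
    rw [two_mul, Nat.add_right_comm, ← h.inner_pow, ← h.inner_pow, pow_succ_mulVec]
    exact h.le _
  obtain ⟨i, rfl | rfl⟩ := Nat.even_or_odd' k
  · exact heven i
  · -- `P (1 - P) = P (1 - P) P + (1 - P) P (1 - P)`
    have h1 := heven (i + 1)
    have h2 := h.nonneg ((P.1 ^ i) *ᵥ f - P.1 *ᵥ ((P.1 ^ i) *ᵥ f))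
    have h3 := h.inner_pow_sub ((P.1 ^ i) *ᵥ f) 1
    rw [pow_one] at h3
    rw [h3] at h2
    have h4 : ∀ j, weightedInner π ((P.1 ^ j) *ᵥ ((P.1 ^ i) *ᵥ f)) ((P.1 ^ i) *ᵥ f) =
        weightedInner π ((P.1 ^ (2 * i + j)) *ᵥ f) f := fun j => by
      rw [mulVec_mulVec, ← pow_add, h.inner_pow]
      congr 3
      omega
    have h5 := h4 1
    rw [pow_one] at h5
    rw [h4, h4, h5] at h2
    have h6 : 2 * (i + 1) = 2 * i + 1 + 1 := by ring
    rw [h6] at h1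
    simp only [← Nat.add_assoc] at h2
    linarith

end IsPositiveContraction

lemma mul_le_sum_of_antitone {c : ℕ → ℝ} (hc : Antitone c) (n j : ℕ) :
    (j + 1) * c (n + j) ≤ ∑ i ∈ Finset.range (j + 1), c (n + i) := by
  have := Finset.card_nsmul_le_sum (Finset.range (j + 1)) (fun i => c (n + i)) (c (n + j))
    fun i hi => hc (by have := Finset.mem_range.1 hi; omega)
  simpa using this

/-- Spectrally, this is `λ ^ m * (1 - λ) ≤ 1 / (m + 1)` on `[0, 1]`. -/
lemma IsPositiveContraction.sq_mul_inner_le {P : TransitionMatrix V} {π : V → ℝ}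
    (h : IsPositiveContraction P π) (hπ : ∀ x, 0 ≤ π x) (f : V → ℝ) (m : ℕ) :
    ((m : ℝ) + 1) ^ 2 * weightedInner π ((P.1 ^ m) *ᵥ (f - P.1 *ᵥ f))
      ((P.1 ^ m) *ᵥ (f - P.1 *ᵥ f)) ≤ weightedInner π f f := by
  set a : ℕ → ℝ := fun k => weightedInner π ((P.1 ^ k) *ᵥ f) f with ha
  set b : ℕ → ℝ := fun k => weightedInner π ((P.1 ^ k) *ᵥ (f - P.1 *ᵥ f)) (f - P.1 *ᵥ f) with hb
  have hba : ∀ k, b k = (a k - a (k + 1)) - (a (k + 1) - a (k + 2)) := fun k => by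
    simp only [hb, ha, h.inner_pow_sub]; ring
  have hb0 : ∀ k, 0 ≤ b k := h.inner_pow_nonneg hπ _
  have hbanti : Antitone b := antitone_nat_of_succ_le (h.inner_pow_succ_le _)
  have hcanti : Antitone fun k => a k - a (k + 1) :=
    antitone_nat_of_succ_le fun k => by
      have h1 := hb0 k
      rw [hba] at h1
      linarith
  have hc0 : ∀ k, 0 ≤ a k - a (k + 1) := fun k => sub_nonneg.2 (h.inner_pow_succ_le f k)
  have h1 : (m + 1) * (a m - a (m + 1)) ≤ a 0 := by
    have := mul_le_sum_of_antitone hcanti 0 m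
    simp only [zero_add] at this
    rw [Finset.sum_range_sub'] at this
    linarith [h.inner_pow_nonneg hπ f (m + 1)]
  have h2 : (m + 1) * b (m + m) ≤ a m - a (m + 1) := by
    have h3 := mul_le_sum_of_antitone hbanti m m
    have h4 : ∑ i ∈ Finset.range (m + 1), b (m + i) =
        ∑ i ∈ Finset.range (m + 1), ((fun i => a (m + i) - a (m + i + 1)) i -
          (fun i => a (m + i) - a (m + i + 1)) (i + 1)) :=
      Finset.sum_congr rfl fun i _ => hba _
    rw [h4, Finset.sum_range_sub'] at h3
    have := hc0 (m + (m + 1))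
    simp only [add_zero] at h3
    linarith
  have h5 : weightedInner π f f = a 0 := by simp [ha]
  rw [h.inner_pow, h5]
  calc ((m : ℝ) + 1) ^ 2 * b (m + m) = (m + 1) * ((m + 1) * b (m + m)) := by ring
    _ ≤ (m + 1) * (a m - a (m + 1)) := mul_le_mul_of_nonneg_left h2 (by positivity)
    _ ≤ a 0 := h1

lemma IsPositiveContraction.sum_abs_le {P : TransitionMatrix V} {π : V → ℝ}
    (h : IsPositiveContraction P π) (hπ : IsProbVector π) {f : V → ℝ} (hf : ∀ x, |f x| ≤ 1)
    (m : ℕ) :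
    ∑ x, π x * |((P.1 ^ (m + 1)) *ᵥ f) x - ((P.1 ^ m) *ᵥ f) x| ≤ 1 / (m + 1) := by
  have hm : (0 : ℝ) < m + 1 := by positivity
  set u := (P.1 ^ m) *ᵥ (f - P.1 *ᵥ f) with hu
  have h1 : ∀ x, |((P.1 ^ (m + 1)) *ᵥ f) x - ((P.1 ^ m) *ᵥ f) x| = |u x| := fun x => by
    rw [hu, mulVec_sub, mulVec_mulVec, ← pow_succ, Pi.sub_apply, abs_sub_comm]
  have h2 : ((m : ℝ) + 1) ^ 2 * weightedInner π u u ≤ 1 := by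
    refine (h.sq_mul_inner_le hπ.1 f m).trans ?_
    rw [← hπ.2]
    refine Finset.sum_le_sum fun x _ => ?_
    have : f x * f x ≤ 1 := by
      have := abs_le.1 (hf x); nlinarith
    nlinarith [hπ.1 x]
  have h3 : ∀ x, |u x| ≤ ((m + 1) * (u x * u x) + 1 / (m + 1)) / 2 := fun x => by
    have h4 : 0 ≤ (((m : ℝ) + 1) * |u x| - 1) ^ 2 / (m + 1) := by positivity
    have h5 : (((m : ℝ) + 1) * |u x| - 1) ^ 2 / (m + 1) =
        (m + 1) * (|u x| * |u x|) - 2 * |u x| + 1 / (m + 1) := by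
      field_simp; ring
    rw [abs_mul_abs_self] at h5
    linarith
  simp only [h1]
  calc ∑ x, π x * |u x| ≤ ∑ x, π x * (((m + 1) * (u x * u x) + 1 / (m + 1)) / 2) :=
        Finset.sum_le_sum fun x _ => mul_le_mul_of_nonneg_left (h3 x) (hπ.1 x)
    _ = ((m + 1) * weightedInner π u u + 1 / (m + 1) * ∑ x, π x) / 2 := by
        simp only [weightedInner, Finset.mul_sum, ← Finset.sum_add_distrib, Finset.sum_div]
        exact Finset.sum_congr rfl fun x _ => by ring
    _ ≤ 1 / (m + 1) := by
        rw [hπ.2, mul_one]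
        have : ((m : ℝ) + 1) * weightedInner π u u ≤ 1 / (m + 1) := by
          rw [le_div_iff₀ hm]; linarith
        linarith

/-! ### Time averages and the intersection time -/

/-- The expectation of `f` at a time chosen uniformly in `{0, …, R - 1}`, as a function of the
starting state. -/
def timeAverage (P : TransitionMatrix V) (R : ℕ) (f : V → ℝ) (x : V) : ℝ :=
  (∑ k ∈ Finset.range R, ((P.1 ^ k) *ᵥ f) x) / R

lemma abs_mulVec_timeAverage_sub_le (P : TransitionMatrix V) (R : ℕ) {f : V → ℝ}
    (hf : ∀ x, |f x| ≤ 1) (x : V) :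
    |(P.1 *ᵥ timeAverage P R f) x - timeAverage P R f x| ≤ 2 / R := by
  have h1 : (P.1 *ᵥ timeAverage P R f) x =
      (∑ k ∈ Finset.range R, ((P.1 ^ (k + 1)) *ᵥ f) x) / R := by
    simp only [pow_succ_mulVec]
    simp only [mulVec, dotProduct, timeAverage]
    rw [Finset.sum_comm, Finset.sum_div]
    refine Finset.sum_congr rfl fun y _ => ?_
    rw [← Finset.mul_sum, mul_div_assoc]
  have h2 : (P.1 *ᵥ timeAverage P R f) x - timeAverage P R f x =
      (((P.1 ^ R) *ᵥ f) x - ((P.1 ^ 0) *ᵥ f) x) / R := by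
    rw [h1, timeAverage, ← sub_div, ← Finset.sum_sub_distrib,
      Finset.sum_range_sub fun k => ((P.1 ^ k) *ᵥ f) x]
  rw [h2, abs_div, Nat.abs_cast]
  gcongr
  refine (abs_sub _ _).trans ?_
  linarith [abs_pow_mulVec_le_const P R hf x, abs_pow_mulVec_le_const P 0 hf x]

/-- Short expected intersection times force time averages to be nearly constant: start one chain
at the minimum and the other one at the maximum of the average. The average changes by at most
`2 / R` in mean per step, so by the maximal inequality the two chains are likely to spend the
times `0, …, s` in the lower and in the upper half of its range. -/
lemma timeAverage_sub_le [MeasurableSpace V] [DiscreteMeasurableSpace V]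
    (P : TransitionMatrix V) {T : ℝ} (hT : ∀ x y, expInterTime P x y ≤ ENNReal.ofReal T)
    {s R : ℕ} (hs : 2 * T < s + 1) (hR : 0 < R) (hsR : 192 * s ≤ R) {f : V → ℝ}
    (hf : ∀ x, |f x| ≤ 1) (x y : V) :
    timeAverage P R f y - timeAverage P R f x ≤ 1 / 12 := by
  set F := timeAverage P R f with hF
  obtain ⟨x₀, -, hx₀⟩ := Finset.exists_min_image Finset.univ F ⟨x, Finset.mem_univ x⟩
  obtain ⟨y₀, -, hy₀⟩ := Finset.exists_max_image Finset.univ F ⟨x, Finset.mem_univ x⟩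
  suffices h : F y₀ - F x₀ ≤ 1 / 12 by
    linarith [hx₀ x (Finset.mem_univ x), hy₀ y (Finset.mem_univ y)]
  by_contra! hD
  set a := (F y₀ - F x₀) / 2 with ha
  have hdrift := fun z => abs_le.1 (abs_mulVec_timeAverage_sub_le P R hf z)
  have hconst : ∀ (c : ℝ) (z : V), ∑ w, P.1 z w * c = c := fun c z => by
    rw [← Finset.sum_mul, sum_transition, one_mul]
  have hR' : (0 : ℝ) < R := by exact_mod_cast hR
  have hsR' : (192 : ℝ) * s ≤ R := by exact_mod_cast hsR
  have hp : s * (2 / (R : ℝ)) ≤ 1 / 96 := by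
    rw [mul_div_assoc', div_le_div_iff₀ hR' (by norm_num)]
    linarith
  have hA := one_sub_avoidProb_le P (Finset.univ.filter fun z => a ≤ F z - F x₀)
    (fun z => F z - F x₀) (p := 2 / R) (a := a) (by positivity)
    (fun z => sub_nonneg.2 (hx₀ z (Finset.mem_univ z))) (fun z hz => (Finset.mem_filter.1 hz).2)
    (fun z => by
      simp only [mul_sub, Finset.sum_sub_distrib, hconst]
      have h1 : (P.1 *ᵥ F) z = ∑ w, P.1 z w * F w := rfl
      linarith [(hdrift z).2]) s x₀
  have hB := one_sub_avoidProb_le P (Finset.univ.filter fun z => a ≤ F y₀ - F z)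
    (fun z => F y₀ - F z) (p := 2 / R) (a := a) (by positivity)
    (fun z => sub_nonneg.2 (hy₀ z (Finset.mem_univ z))) (fun z hz => (Finset.mem_filter.1 hz).2)
    (fun z => by
      simp only [mul_sub, Finset.sum_sub_distrib, hconst]
      have h1 : (P.1 *ᵥ F) z = ∑ w, P.1 z w * F w := rfl
      linarith [(hdrift z).1]) s y₀
  have hAB := avoidProb_mul_le_expInterTime P
    (A := Finset.univ.filter fun z => a ≤ F z - F x₀)
    (B := Finset.univ.filter fun z => a ≤ F y₀ - F z) (fun z => by
      simp only [Finset.mem_filter, Finset.mem_univ, true_and]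
      by_contra! h
      linarith [h.1, h.2]) s x₀ y₀
  set α := avoidProb P (Finset.univ.filter fun z => a ≤ F z - F x₀) s x₀
  set β := avoidProb P (Finset.univ.filter fun z => a ≤ F y₀ - F z) s y₀
  -- Since `1 / 24 < a` and the total drift is at most `1 / 96`, each chain leaves its half with
  -- probability at most `1 / 4`, and `(s + 1) * (3 / 4) ^ 2 > T`.
  have hα : 3 / 4 ≤ α := by
    by_contra! h
    have : 0 < a - 1 / 24 := by linarith
    nlinarith
  have hβ : 3 / 4 ≤ β := by
    by_contra! h
    have : 0 < a - 1 / 24 := by linarith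
    nlinarith
  have hαβ : 9 / 16 ≤ α * β := by nlinarith
  have hs1 : (0 : ℝ) < s + 1 := by positivity
  have h3 := (ENNReal.ofReal_le_ofReal_iff' ).1 (hAB.trans (hT x₀ y₀))
  rcases h3 with h3 | h3 <;> nlinarith

/-- If time averages are nearly constant, then the chain is well mixed at time `M + R`: the law
at a uniform time in `{0, …, R - 1}` is nearly `π`, and the remaining number of steps, which is
between `M` and `M + R`, matters little for `π`-most states, by the `L²` decay. -/
lemma IsPositiveContraction.abs_pow_mulVec_sub_le {P : TransitionMatrix V} {π : V → ℝ}
    (h : IsPositiveContraction P π) (hπ : IsStationary P π) {R M : ℕ} (hR : 0 < R)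
    (hRM : 4 * R ≤ M)
    (hav : ∀ f : V → ℝ, (∀ x, |f x| ≤ 1) → ∀ x y,
      timeAverage P R f y - timeAverage P R f x ≤ 1 / 12)
    {f : V → ℝ} (hf : ∀ x, |f x| ≤ 1) (x : V) :
    |((P.1 ^ (M + R)) *ᵥ f) x - ∑ y, π y * f y| ≤ 1 / 2 := by
  have hR' : (0 : ℝ) < R := by exact_mod_cast hR
  have hsum : ∀ f : V → ℝ, ∑ y, π y * timeAverage P R f y = ∑ y, π y * f y := fun f => by
    simp only [timeAverage, mul_div_assoc', ← Finset.sum_div, Finset.mul_sum]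
    rw [Finset.sum_comm]
    simp only [stationary_pow_mulVec hπ, Finset.sum_const, Finset.card_range, nsmul_eq_mul]
    field_simp
  have hav' : ∀ f : V → ℝ, (∀ x, |f x| ≤ 1) → ∀ x,
      |timeAverage P R f x - ∑ y, π y * f y| ≤ 1 / 12 := fun f hf x => by
    have h1 : timeAverage P R f x - ∑ y, π y * f y =
        ∑ y, π y * (timeAverage P R f x - timeAverage P R f y) := by
      simp only [mul_sub, Finset.sum_sub_distrib, ← Finset.sum_mul, hπ.1.2, one_mul, hsum]
    rw [h1]
    calc _ ≤ ∑ y, |π y * (timeAverage P R f x - timeAverage P R f y)| :=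
          Finset.abs_sum_le_sum_abs _ _
      _ ≤ ∑ y, π y * (1 / 12) := by
          refine Finset.sum_le_sum fun y _ => ?_
          rw [abs_mul, abs_of_nonneg (hπ.1.1 y)]
          exact mul_le_mul_of_nonneg_left
            (abs_le.2 ⟨by linarith [hav f hf x y], hav f hf y x⟩) (hπ.1.1 y)
      _ = 1 / 12 := by rw [← Finset.sum_mul, hπ.1.2, one_mul]
  -- `g` dominates the change of `P ^ m f` over the times `m ∈ {M, …, M + R}`.
  set g : V → ℝ := fun z =>
    ∑ i ∈ Finset.range R, |((P.1 ^ (M + i + 1)) *ᵥ f) z - ((P.1 ^ (M + i)) *ᵥ f) z| with hg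
  set g₂ : V → ℝ := fun z => min (g z / 2) 1 with hg₂
  have hg0 : ∀ z, 0 ≤ g z := fun z => Finset.sum_nonneg fun i _ => abs_nonneg _
  have hg₂1 : ∀ z, |g₂ z| ≤ 1 := fun z => by
    rw [abs_of_nonneg (le_min (by linarith [hg0 z]) zero_le_one)]
    exact min_le_right _ _
  have hdom : ∀ j ≤ R, ∀ z, |((P.1 ^ (M + j)) *ᵥ f - (P.1 ^ M) *ᵥ f) z| ≤ 2 * g₂ z :=
    fun j hj z => by
      rw [Pi.sub_apply, hg₂]
      have h1 : |((P.1 ^ (M + j)) *ᵥ f) z - ((P.1 ^ M) *ᵥ f) z| ≤ g z := by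
        have h2 := Finset.sum_range_sub (fun i => ((P.1 ^ (M + i)) *ᵥ f) z) j
        simp only [add_zero, ← add_assoc] at h2
        rw [← h2]
        refine (Finset.abs_sum_le_sum_abs _ _).trans ?_
        exact Finset.sum_le_sum_of_subset_of_nonneg (Finset.range_mono hj)
          fun i _ _ => abs_nonneg _
      have h3 : |((P.1 ^ (M + j)) *ᵥ f) z - ((P.1 ^ M) *ᵥ f) z| ≤ 2 := by
        refine (abs_sub _ _).trans ?_
        linarith [abs_pow_mulVec_le_const P (M + j) hf z, abs_pow_mulVec_le_const P M hf z]
      rcases min_cases (g z / 2) 1 with hm | hm <;> simp only [hm.1] <;> linarith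
  have hπg : ∑ z, π z * g₂ z ≤ 1 / 8 := by
    have h1 : ∑ z, π z * g z ≤ 1 / 4 := by
      calc ∑ z, π z * g z = ∑ i ∈ Finset.range R, ∑ z, π z *
            |((P.1 ^ (M + i + 1)) *ᵥ f) z - ((P.1 ^ (M + i)) *ᵥ f) z| := by
            simp only [hg, Finset.mul_sum]
            rw [Finset.sum_comm]
        _ ≤ ∑ i ∈ Finset.range R, 1 / (4 * (R : ℝ)) := by
            refine Finset.sum_le_sum fun i _ => (h.sum_abs_le hπ.1 hf (M + i)).trans ?_
            have : 4 * (R : ℝ) ≤ M := by exact_mod_cast hRM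
            push_cast
            gcongr
            have : (0 : ℝ) ≤ i := by positivity
            linarith
        _ = 1 / 4 := by simp; field_simp
    calc ∑ z, π z * g₂ z ≤ ∑ z, π z * (g z / 2) :=
          Finset.sum_le_sum fun z _ => mul_le_mul_of_nonneg_left (min_le_left _ _) (hπ.1.1 z)
      _ = (∑ z, π z * g z) / 2 := by rw [Finset.sum_div]; simp only [mul_div_assoc]
      _ ≤ 1 / 8 := by linarith
  have hmain : |((P.1 ^ (M + R)) *ᵥ f) x - timeAverage P R ((P.1 ^ M) *ᵥ f) x| ≤
      2 * timeAverage P R g₂ x := by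
    have h1 : ((P.1 ^ (M + R)) *ᵥ f) x - timeAverage P R ((P.1 ^ M) *ᵥ f) x =
        (∑ k ∈ Finset.range R, ((P.1 ^ k) *ᵥ
          ((P.1 ^ (M + (R - k))) *ᵥ f - (P.1 ^ M) *ᵥ f)) x) / R := by
      have h2 : ∀ k ∈ Finset.range R, ((P.1 ^ k) *ᵥ
          ((P.1 ^ (M + (R - k))) *ᵥ f - (P.1 ^ M) *ᵥ f)) x =
          ((P.1 ^ (M + R)) *ᵥ f) x - ((P.1 ^ k) *ᵥ ((P.1 ^ M) *ᵥ f)) x := fun k hk => by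
        have hk := Finset.mem_range.1 hk
        rw [mulVec_sub, mulVec_mulVec, ← pow_add,
          show k + (M + (R - k)) = M + R by omega, Pi.sub_apply]
      rw [Finset.sum_congr rfl h2, Finset.sum_sub_distrib, Finset.sum_const, Finset.card_range,
        nsmul_eq_mul, timeAverage]
      field_simp
    rw [h1, abs_div, Nat.abs_cast, timeAverage, mul_div_assoc', Finset.mul_sum]
    gcongr
    refine (Finset.abs_sum_le_sum_abs _ _).trans (Finset.sum_le_sum fun k _ => ?_)
    have h3 := abs_pow_mulVec_le P k (g := fun z => 2 * g₂ z) (hdom (R - k) (by omega)) x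
    refine h3.trans_eq ?_
    rw [show (fun z => 2 * g₂ z) = (2 : ℝ) • g₂ from rfl, mulVec_smul, Pi.smul_apply, smul_eq_mul]
  have h4 := abs_le.1 (hav' g₂ hg₂1 x)
  have h5 := abs_le.1 (hav' _ (abs_pow_mulVec_le_const P M hf) x)
  rw [stationary_pow_mulVec hπ] at h5
  have h6 := abs_le.1 hmain
  refine abs_le.2 ⟨?_, ?_⟩ <;> linarith [h4.2, h5.1, h5.2, h6.1, h6.2]

omit [DecidableEq V] in
lemma tvDist_le_of_forall_abs_le {μ ν : V → ℝ} {c : ℝ}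
    (h : ∀ f : V → ℝ, (∀ x, |f x| ≤ 1) → |∑ y, μ y * f y - ∑ y, ν y * f y| ≤ 2 * c) :
    tvDist μ ν ≤ c := by
  have h1 := h (fun y => SignType.sign (μ y - ν y)) fun y => by
    rcases lt_trichotomy (μ y - ν y) 0 with h0 | h0 | h0 <;> simp [h0]
  have h2 : ∑ y, |μ y - ν y| = ∑ y, μ y * (SignType.sign (μ y - ν y) : ℝ) -
      ∑ y, ν y * (SignType.sign (μ y - ν y) : ℝ) := by
    rw [← Finset.sum_sub_distrib]
    refine Finset.sum_congr rfl fun y _ => ?_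
    rw [← sub_mul, self_mul_sign]
  rw [tvDist, h2]
  linarith [(abs_le.1 h1).2]

/-- The mixing time of a lazy reversible chain is at most a constant times its expected
intersection time. -/
lemma tmix_le_tI [MeasurableSpace V] [DiscreteMeasurableSpace V] {P : TransitionMatrix V}
    {π : V → ℝ} (hP : IsPositiveContraction P π) (hπ : IsStationary P π) :
    tmix P π ≤ (1920 : ℝ≥0) * tI P := by
  rcases subsingleton_or_nontrivial V with hV | hV
  · have : tmix P π ≤ (0 : ℕ) := by
      refine iInf₂_le 0 fun x => ?_
      have hπx : π x = 1 := by
        have := hπ.1.2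
        rwa [Fintype.sum_subsingleton _ x] at this
      simp [tvDist, Fintype.sum_subsingleton _ x, hπx]
    rw [Nat.cast_zero] at this
    exact this.trans zero_le
  by_cases hTtop : tI P = ∞
  · rw [hTtop, ENNReal.mul_top (by norm_num)]; exact le_top
  set T := (tI P).toReal with hTdef
  have hT' : tI P = ENNReal.ofReal T := (ENNReal.ofReal_toReal hTtop).symm
  have hT : ∀ x y, expInterTime P x y ≤ ENNReal.ofReal T := fun x y => by
    rw [← hT']
    exact le_iSup₂ (f := fun x y => expInterTime P x y) x y
  -- Distinct starting states cannot intersect at time `0`. So `s` below is positive.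
  have hT1 : 1 ≤ T := by
    obtain ⟨x, y, hxy⟩ := exists_pair_ne V
    have h1 := avoidProb_mul_le_expInterTime P (A := Finset.univ.erase x) (B := {x})
      (fun z => by by_cases hz : z = x <;> simp [hz]) 0 x y
    have h2 := h1.trans (hT x y)
    simp only [avoidProb, Finset.mem_erase, Finset.mem_singleton, hxy.symm] at h2
    simpa using h2
  set s := ⌊2 * T⌋₊ with hs
  have hs1 : 0 < s := Nat.floor_pos.2 (by linarith)
  have hmem : 4 * (192 * s) + 192 * s ∈ {t : ℕ | ∀ x, tvDist ((P.1 ^ t) x) π ≤ 1 / 4} := by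
    intro x
    refine tvDist_le_of_forall_abs_le fun f hf => ?_
    have := hP.abs_pow_mulVec_sub_le hπ (R := 192 * s) (M := 4 * (192 * s)) (by omega) le_rfl
      (fun f hf x y => timeAverage_sub_le P hT (Nat.lt_floor_add_one _) (by omega) le_rfl hf x y)
      hf x
    norm_num
    exact this
  calc tmix P π ≤ ((4 * (192 * s) + 192 * s : ℕ) : ℝ≥0∞) := iInf₂_le _ hmem
    _ = ENNReal.ofReal (960 * s) := by
        rw [← ENNReal.ofReal_natCast]; congr 1; push_cast; ring
    _ ≤ ENNReal.ofReal (1920 * T) := by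
        refine ENNReal.ofReal_le_ofReal ?_
        linarith [Nat.floor_le (show 0 ≤ 2 * T by linarith)]
    _ = (1920 : ℝ≥0) * tI P := by
        rw [ENNReal.ofReal_mul (by norm_num), hT']; norm_num

/-! ### Branches of a tree -/

section Branch

omit [Fintype V] [DecidableEq V]

/-- For an edge `v u` of a tree, the set of vertices on the side of `u`: those that remain connected
to `u` when the edge is deleted. -/
def branch (G : SimpleGraph V) (v u : V) : Set V :=
  {z | (G.deleteEdges {s(v, u)}).Reachable u z}

variable {G : SimpleGraph V} {v u : V}

lemma notMem_branch (hG : G.IsTree) (h : G.Adj v u) : v ∉ branch G v u := fun hv =>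
  SimpleGraph.isBridge_iff.1 (SimpleGraph.isAcyclic_iff_forall_adj_isBridge.1 hG.isAcyclic h)
    hv.symm

/-- The only edge leaving a branch is the one it is defined by. -/
lemma eq_of_adj_of_notMem_branch (hG : G.IsTree) (h : G.Adj v u) {z w : V}
    (hz : z ∈ branch G v u) (hzw : G.Adj z w) (hw : w ∉ branch G v u) : z = u ∧ w = v := by
  by_cases he : s(z, w) = s(v, u)
  · rcases Sym2.eq_iff.1 he with ⟨rfl, rfl⟩ | h'
    · exact absurd hz (notMem_branch hG h)
    · exact h'
  · refine absurd (SimpleGraph.Reachable.trans hz (SimpleGraph.Adj.reachable ?_)) hw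
    rw [SimpleGraph.deleteEdges_adj]
    exact ⟨hzw, he⟩

lemma dist_lt_length_of_mem_branch (hG : G.IsTree) (h : G.Adj v u) {x z : V} (p : G.Walk x z)
    (hz : z ∈ branch G v u) (hx : x ∉ branch G v u) : G.dist u z + 1 ≤ p.length := by
  induction p with
  | nil => exact absurd hz hx
  | @cons x y z hxy q ih =>
    rw [SimpleGraph.Walk.length_cons]
    by_cases hy : y ∈ branch G v u
    · obtain ⟨rfl, -⟩ := eq_of_adj_of_notMem_branch hG h hy hxy.symm hx
      have := SimpleGraph.dist_le q
      omega
    · have := ih hz hy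
      omega

lemma dist_add_one_le_of_mem_branch (hG : G.IsTree) (h : G.Adj v u) {z : V}
    (hz : z ∈ branch G v u) : G.dist u z + 1 ≤ G.dist v z := by
  obtain ⟨p, hp⟩ := hG.connected.exists_walk_length_eq_dist v z
  rw [← hp]
  exact dist_lt_length_of_mem_branch hG h p hz (notMem_branch hG h)

lemma exists_mem_branch (hG : G.IsTree) {x : V} (hx : x ≠ v) :
    ∃ u, G.Adj v u ∧ x ∈ branch G v u := by
  classical
  obtain ⟨p, hp⟩ := (hG.connected v x).exists_isPath
  cases p with
  | nil => exact absurd rfl hx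
  | @cons _ u _ h q =>
    refine ⟨u, h, SimpleGraph.reachable_deleteEdges_iff_exists_walk.2 ⟨q, fun he => ?_⟩⟩
    exact ((SimpleGraph.Walk.cons_isPath_iff h q).1 hp).2
      (SimpleGraph.Walk.fst_mem_support_of_mem_edges q he)

end Branch

omit [DecidableEq V] in
/-- A tree has a central vertex: one all of whose branches have mass at most one half. It is
found by minimizing the mean distance to a random vertex. -/
lemma exists_central_vertex {G : SimpleGraph V} (hG : G.IsTree) {π : V → ℝ}
    (hπ : IsProbVector π) :
    ∃ v, ∀ u, G.Adj v u → ∑ z, π z * (branch G v u).indicator 1 z ≤ 1 / 2 := by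
  have := hG.connected.nonempty
  obtain ⟨v, -, hv⟩ := Finset.exists_min_image Finset.univ
    (fun v => ∑ z, π z * (G.dist v z : ℝ)) Finset.univ_nonempty
  refine ⟨v, fun u h => ?_⟩
  have h1 := hv u (Finset.mem_univ u)
  have h2 : ∑ z, π z * (G.dist u z : ℝ) ≤
      ∑ z, π z * (G.dist v z + 1 - 2 * (branch G v u).indicator 1 z) := by
    refine Finset.sum_le_sum fun z _ => mul_le_mul_of_nonneg_left ?_ (hπ.1 z)
    by_cases hz : z ∈ branch G v u
    · have : (G.dist u z : ℝ) + 1 ≤ G.dist v z := by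
        exact_mod_cast dist_add_one_le_of_mem_branch hG h hz
      rw [Set.indicator_of_mem hz, Pi.one_apply]
      linarith
    · have h3 : G.dist u z ≤ G.dist u v + G.dist v z := hG.connected.dist_triangle
      rw [SimpleGraph.dist_eq_one_iff_adj.2 h.symm] at h3
      have : (G.dist u z : ℝ) ≤ 1 + G.dist v z := by exact_mod_cast h3
      rw [Set.indicator_of_notMem hz]
      linarith
  have h4 : ∑ z, π z * (G.dist v z + 1 - 2 * (branch G v u).indicator (1 : V → ℝ) z) =
      ∑ z, π z * (G.dist v z : ℝ) + ∑ z, π z -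
        2 * ∑ z, π z * (branch G v u).indicator 1 z := by
    rw [Finset.mul_sum, ← Finset.sum_add_distrib, ← Finset.sum_sub_distrib]
    exact Finset.sum_congr rfl fun z _ => by ring
  rw [hπ.2] at h4
  linarith

/-! ### Nearest-neighbour chains on a tree -/

/-- A chain that only moves along edges of the graph (or stays put). -/
def IsNearestNeighbour (P : TransitionMatrix V) (G : SimpleGraph V) : Prop :=
  ∀ x y, x ≠ y → ¬ G.Adj x y → P.1 x y = 0

/-- To leave a branch the chain has to visit its base point. -/
lemma avoidProb_le_pow_mulVec {G : SimpleGraph V} (hG : G.IsTree) {P : TransitionMatrix V}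
    (hP : IsNearestNeighbour P G) {v u : V} (h : G.Adj v u) (t : ℕ) {z : V}
    (hz : z ∈ branch G v u) :
    avoidProb P {v} t z ≤ ((P.1 ^ t) *ᵥ (branch G v u).indicator 1) z := by
  have hne : ∀ {z}, z ∈ branch G v u → z ∉ ({v} : Finset V) := fun hz hzv =>
    notMem_branch hG h (Finset.mem_singleton.1 hzv ▸ hz)
  induction t generalizing z with
  | zero => simp [avoidProb, hne hz, hz]
  | succ t ih =>
    simp only [avoidProb, hne hz, if_false, pow_succ_mulVec]
    refine Finset.sum_le_sum fun w _ => ?_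
    change P.1 z w * _ ≤ P.1 z w * _
    by_cases hw : w ∈ branch G v u
    · exact mul_le_mul_of_nonneg_left (ih hw) (transition_nonneg P z w)
    by_cases hzw : G.Adj z w
    · obtain ⟨-, rfl⟩ := eq_of_adj_of_notMem_branch hG h hz hzw hw
      rw [avoidProb_of_mem P t (Finset.mem_singleton_self w), mul_zero]
      refine mul_nonneg (transition_nonneg P z w) ?_
      have := abs_pow_mulVec_le P t (f := 0) (g := (branch G w u).indicator 1) (fun x => by
        rw [Pi.zero_apply, abs_zero]
        exact Set.indicator_nonneg (fun _ _ => zero_le_one) x) w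
      exact (abs_nonneg _).trans this
    · rw [hP z w (fun h' => hw (h' ▸ hz)) hzw]
      simp

omit [DecidableEq V] in
lemma sum_mul_indicator_le {μ ν : V → ℝ} (h : ∑ y, μ y = ∑ y, ν y) (S : Set V) :
    ∑ y, μ y * S.indicator 1 y ≤ ∑ y, ν y * S.indicator 1 y + tvDist μ ν := by
  have h1 : ∑ y, (μ y - ν y) * S.indicator 1 y ≤ ∑ y, (|μ y - ν y| + (μ y - ν y)) / 2 := by
    refine Finset.sum_le_sum fun y _ => ?_
    by_cases hy : y ∈ S
    · rw [Set.indicator_of_mem hy, Pi.one_apply]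
      linarith [le_abs_self (μ y - ν y)]
    · rw [Set.indicator_of_notMem hy]
      linarith [neg_abs_le (μ y - ν y)]
  rw [← Finset.sum_div, Finset.sum_add_distrib, Finset.sum_sub_distrib, h, sub_self] at h1
  simp only [sub_mul, Finset.sum_sub_distrib] at h1
  rw [tvDist]
  linarith

/-- On a tree both chains visit the central vertex soon after the mixing time. -/
lemma tI_le_tmix [MeasurableSpace V] [DiscreteMeasurableSpace V] {G : SimpleGraph V}
    (hG : G.IsTree) {P : TransitionMatrix V} (hP : IsNearestNeighbour P G) {π : V → ℝ}
    (hπ : IsProbVector π) : tI P ≤ 8 * tmix P π := by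
  obtain ⟨v, hv⟩ := exists_central_vertex hG hπ
  have hmul : 8 * tmix P π =
      ⨅ t ∈ {t : ℕ | ∀ x, tvDist ((P.1 ^ t) x) π ≤ 1 / 4}, 8 * (t : ℝ≥0∞) := by
    simp only [tmix, ENNReal.mul_iInf_of_ne (show (8 : ℝ≥0∞) ≠ 0 by norm_num)
      (show (8 : ℝ≥0∞) ≠ ∞ by norm_num)]
  rw [hmul]
  refine le_iInf₂ fun t ht => iSup₂_le fun x y => expInterTime_le P v (fun z => ?_) x y
  by_cases hz : z = v
  · rw [avoidProb_of_mem P t (Finset.mem_singleton.2 hz)]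
    norm_num
  · obtain ⟨u, hu, hzu⟩ := exists_mem_branch hG hz
    have h1 := avoidProb_le_pow_mulVec hG hP hu t hzu
    have h2 := sum_mul_indicator_le (μ := (P.1 ^ t) z) (ν := π)
      ((sum_transition (P ^ t) z).trans hπ.2.symm) (branch G v u)
    have h3 : ((P.1 ^ t) *ᵥ (branch G v u).indicator 1) z =
        ∑ y, (P.1 ^ t) z y * (branch G v u).indicator 1 y := rfl
    linarith [hv u hu, ht z]

/-- Stationarity balances the flow between a branch and its complement, which only uses a single
edge. -/
lemma isReversible_of_isTree {G : SimpleGraph V} (hG : G.IsTree) {P : TransitionMatrix V}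
    (hP : IsNearestNeighbour P G) {π : V → ℝ} (hπ : IsStationary P π) : IsReversible P π := by
  intro v u
  by_cases hvu : v = u
  · rw [hvu]
  by_cases h : G.Adj v u
  swap
  · rw [hP v u hvu h, hP u v (Ne.symm hvu) fun h' => h h'.symm, mul_zero, mul_zero]
  set χ : V → ℝ := (branch G v u).indicator 1 with hχ
  have hu : u ∈ branch G v u := SimpleGraph.Reachable.refl u
  have h1 : ∑ x, ∑ y, π x * P.1 x y * (χ y - χ x) = 0 := by
    have h2 := stationary_mulVec hπ χ
    have h3 : ∑ x, π x * χ x = ∑ x, ∑ y, π x * P.1 x y * χ x := by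
      refine Finset.sum_congr rfl fun x _ => ?_
      rw [← Finset.sum_mul, ← Finset.mul_sum, sum_transition, mul_one]
    rw [h3] at h2
    simp only [mul_sub, Finset.sum_sub_distrib]
    rw [sub_eq_zero, ← h2]
    simp only [mulVec, dotProduct, Finset.mul_sum, mul_assoc]
  have h4 : ∀ x y, π x * P.1 x y * (χ y - χ x) =
      (if x = v then if y = u then π v * P.1 v u else 0 else 0) -
        (if x = u then if y = v then π u * P.1 u v else 0 else 0) := fun x y => by
    have hχv : χ v = 0 := Set.indicator_of_notMem (notMem_branch hG h) _
    have hχu : χ u = 1 := Set.indicator_of_mem hu _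
    by_cases hA : x = v ∧ y = u
    · obtain ⟨rfl, rfl⟩ := hA
      simp [hvu, hχv, hχu]
    by_cases hB : x = u ∧ y = v
    · obtain ⟨rfl, rfl⟩ := hB
      simp [Ne.symm hvu, hχv, hχu]
    have hrhs : (if x = v then if y = u then π v * P.1 v u else 0 else 0) -
        (if x = u then if y = v then π u * P.1 u v else 0 else 0) = 0 := by
      rw [← ite_and, ← ite_and, if_neg hA, if_neg hB, sub_zero]
    rw [hrhs]
    by_cases hxy : G.Adj x y
    · by_cases hx : x ∈ branch G v u <;> by_cases hy : y ∈ branch G v u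
      · simp [hχ, hx, hy]
      · exact absurd (eq_of_adj_of_notMem_branch hG h hx hxy hy) hB
      · exact absurd (eq_of_adj_of_notMem_branch hG h hy hxy.symm hx).symm hA
      · simp [hχ, hx, hy]
    · by_cases hxy' : x = y
      · simp [hxy']
      · simp [hP x y hxy' hxy]
  simp only [h4, Finset.sum_sub_distrib] at h1
  simpa [sub_eq_zero] using h1

lemma lazyVersion_apply (P : TransitionMatrix V) (x y : V) :
    (lazyVersion P).1 x y = (P.1 x y + if x = y then 1 else 0) / 2 := by
  change ((1 / 2 : ℝ) • (P.1 + 1)) x y = _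
  rw [Matrix.smul_apply, Matrix.add_apply, Matrix.one_apply, smul_eq_mul]
  ring

lemma isStationary_lazyVersion_iff {P : TransitionMatrix V} {π : V → ℝ} :
    IsStationary (lazyVersion P) π ↔ IsStationary P π := by
  refine and_congr_right fun _ => forall_congr' fun y => ?_
  have : ∑ x, π x * (lazyVersion P).1 x y = (∑ x, π x * P.1 x y + π y) / 2 := by
    simp only [lazyVersion_apply, mul_div_assoc', mul_add, ← Finset.sum_div,
      Finset.sum_add_distrib]
    simp
  rw [this]
  constructor <;> intro h <;> linarith

lemma isNearestNeighbour_weightedWalk {G : SimpleGraph V} (W : EdgeWeights G) :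
    IsNearestNeighbour (weightedWalk W) G := by
  intro x y hxy h
  simp [weightedWalk, hxy, W.zero x y h]

lemma IsNearestNeighbour.lazyVersion {G : SimpleGraph V} {P : TransitionMatrix V}
    (hP : IsNearestNeighbour P G) : IsNearestNeighbour (lazyVersion P) G := by
  intro x y hxy h
  simp [lazyVersion_apply, hP x y hxy h, hxy]

end IntersectionTime

end

open IntersectionTime in
theorem corollary2 :
    (∃ C : ℝ≥0, 0 < C ∧
      ∀ (V : Type*) [Fintype V] [DecidableEq V] [MeasurableSpace V] [DiscreteMeasurableSpace V]
        (P : TransitionMatrix V) (π : V → ℝ),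
        P.1.IsIrreducible → IsStationary P π → IsReversible P π →
          tmix (lazyVersion P) π ≤ C * tI (lazyVersion P)) ∧
    (∃ c C : ℝ≥0, 0 < c ∧ 0 < C ∧
      ∀ (V : Type*) [Fintype V] [DecidableEq V] [MeasurableSpace V] [DiscreteMeasurableSpace V]
        (G : SimpleGraph V) (W : EdgeWeights G) (π : V → ℝ),
        G.IsTree → IsStationary (lazyVersion (weightedWalk W)) π →
          c * tI (lazyVersion (weightedWalk W)) ≤ tmix (lazyVersion (weightedWalk W)) π ∧
          tmix (lazyVersion (weightedWalk W)) π ≤ C * tI (lazyVersion (weightedWalk W))) := by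
  refine ⟨⟨1920, by norm_num, ?_⟩, ⟨8⁻¹, 1920, by norm_num, by norm_num, ?_⟩⟩
  · intro V _ _ _ _ P π _ hπ hrev
    exact tmix_le_tI (isPositiveContraction_lazyVersion hπ hrev)
      (isStationary_lazyVersion_iff.2 hπ)
  · intro V _ _ _ _ G W π hG hπ
    have hnn := isNearestNeighbour_weightedWalk W
    have hπ' := isStationary_lazyVersion_iff.1 hπ
    refine ⟨?_, tmix_le_tI (isPositiveContraction_lazyVersion hπ'
      (isReversible_of_isTree hG hnn hπ')) hπ⟩
    calc ((8⁻¹ : ℝ≥0) : ℝ≥0∞) * tI (lazyVersion (weightedWalk W))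
        ≤ ((8⁻¹ : ℝ≥0) : ℝ≥0∞) * (8 * tmix (lazyVersion (weightedWalk W)) π) :=
          mul_le_mul_right (tI_le_tmix hG hnn.lazyVersion hπ.1) _
      _ = tmix (lazyVersion (weightedWalk W)) π := by
          rw [← mul_assoc, ENNReal.coe_inv (by norm_num)]
          norm_num
          rw [ENNReal.inv_mul_cancel (by norm_num) (by norm_num), one_mul]
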